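/- Let $D\ge 3$ be an integer, let $d\ge 0$ and $\beta,\gamma\in\mathbb R$. For each $n$, let $J=(J_S)$, indexed by the $D$-element subsets $S\subset[n]$, have i.i.d. entries $J_S\sim\mathrm{Bernoulli}\big(nd/(D\binom nD)\big)$ (a valid distribution for all large $n$; denoted $J\sim\mathrm{Diluted}(D,n,d)$). On $n$ qubits put $H[J]=\sum_{S}J_S\prod_{k\in S}Z_k$, $H_B=\sum_{k}X_k$, and let $$|\Psi(J,\beta,\gamma)\rangle=e^{-i\frac{\beta}{2}H_B}\,e^{-i\frac{\gamma}{2}H[J]}\,|+\rangle^{\otimes n}$$ be the $p=1$ QAOA state. Write bitstrings $s\in\{0,1\}^3$ as $s=s_2s_1s_0$ and set $$B_{\beta,s}=\Big(\cos\tfrac\beta2\Big)^{[s_0=s_1]+[s_2=s_1]}\Big(i\sin\tfrac\beta2\Big)^{[s_0\ne s_1]+[s_2\ne s_1]},\qquad \varphi(\gamma,s)=\tfrac{\gamma}{2}\big((-1)^{s_2}-(-1)^{s_0}\big),$$ $$\mathcal L=\{s: s_0\neq s_1\}=\{001,010,101,110\}.$$ For nonnegative integers $(D_s)_{s\in\{0,1\}^3}$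 let $\bigoplus_s s^{\oplus D_s}$ denote the bitwise XOR of those $s$ for which $D_s$ is odd. Then the limit below exists and $$\lim_{n\to\infty}\mathbf E_{J\sim\mathrm{Diluted}(D,n,d)}\Big[\Big\langle\Psi(J,\beta,\gamma)\Big|\frac{H[J]}{n}\Big|\Psi(J,\beta,\gamma)\Big\rangle\Big]$$ $$=\frac{d}{2^D D}\sum_{\substack{(D_s)_{s\in\{0,1\}^3},\ D_s\ge 0\\ \sum_s D_s=D}}\binom{D}{(D_s)_s}\,e^{i\varphi(\gamma,\bigoplus_s s^{\oplus D_s})}\,(-1)^{\sum_s D_s s_1}\,(-1)^{\sum_{s\in\mathcal L}D_s}\,e^{-(D_{001}+D_{011}+D_{100}+D_{110})\,d\,(1-\cos\gamma)}\prod_{s}B_{\beta,s}^{D_s}.$$ -/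

import Mathlib

open MeasureTheory ProbabilityTheory Filter Topology Matrix

noncomputable section

namespace DilutedSpin

/-- Pauli X. -/
def pauliX : Matrix (Fin 2) (Fin 2) ℂ := !![0, 1; 1, 0]

/-- Pauli Z. -/
def pauliZ : Matrix (Fin 2) (Fin 2) ℂ := !![1, 0; 0, -1]

/-- Operators on `n` qubits, as matrices in the computational basis. -/
abbrev QubitOp (n : ℕ) : Type := Matrix (Fin n → Fin 2) (Fin n → Fin 2) ℂ

/-- The tensor product `A₀ ⊗ ⋯ ⊗ Aₙ₋₁` of single-qubit operators. -/
def tensorOp {n : ℕ} (A : Fin n → Matrix (Fin 2) (Fin 2) ℂ) : QubitOp n :=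
  fun x y => ∏ k, A k (x k) (y k)

/-- `X_k`: Pauli X on qubit `k`, the identity on the other qubits. -/
def opX {n : ℕ} (k : Fin n) : QubitOp n :=
  tensorOp fun j => if j = k then pauliX else 1

/-- `∏_{k ∈ S} Z_k`: Pauli Z on each qubit of `S`, the identity on the other qubits. -/
def opZ {n : ℕ} (S : Finset (Fin n)) : QubitOp n :=
  tensorOp fun j => if j ∈ S then pauliZ else 1

/-- The `D`-element subsets of the `n` vertices. -/
abbrev Hyperedge (n D : ℕ) : Type := {S : Finset (Fin n) // S.card = D}

/-- The mixer Hamiltonian `H_B = ∑_k X_k`. -/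
def mixer (n : ℕ) : QubitOp n := ∑ k, opX k

/-- The problem Hamiltonian `H[J] = ∑_{{k₁,…,k_D} ⊂ [n]} J_{k₁…k_D} Z_{k₁} ⋯ Z_{k_D}`. -/
def hamiltonian {n D : ℕ} (J : Hyperedge n D → ℝ) : QubitOp n :=
  ∑ S : Hyperedge n D, (J S : ℂ) • opZ S.1

/-- The state `|+⟩^{⊗ n}`. -/
def plusState (n : ℕ) : (Fin n → Fin 2) → ℂ := fun _ => ((Real.sqrt (2 ^ n) : ℝ) : ℂ)⁻¹

/-- The level-1 QAOA state `e^{-i(β/2) H_B} e^{-i(γ/2) H_C} |+⟩`. -/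
def qaoaState {n : ℕ} (HC : QubitOp n) (β γ : ℝ) : (Fin n → Fin 2) → ℂ :=
  NormedSpace.exp ((-(Complex.I * ((β / 2 : ℝ) : ℂ))) • mixer n) *ᵥ
    (NormedSpace.exp ((-(Complex.I * ((γ / 2 : ℝ) : ℂ))) • HC) *ᵥ plusState n)

/-- The matrix element `⟨ψ|A|ψ⟩`. -/
def braket {n : ℕ} (ψ : (Fin n → Fin 2) → ℂ) (A : QubitOp n) : ℂ := star ψ ⬝ᵥ (A *ᵥ ψ)

/-- The edge probability `n d / (D * binom(n, D))` of the diluted model. It lies in `[0, 1]` for all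
large `n` when `d ≥ 0` and `D ≥ 2`; for the finitely many other `n`, where the model does not
exist, it is projected to `[0, 1]`. -/
def edgeProb (D n : ℕ) (d : ℝ) : unitInterval :=
  Set.projIcc 0 1 zero_le_one ((n : ℝ) * d / ((D : ℝ) * (n.choose D : ℝ)))

/-- `Diluted(D, n, d)`: the law of a tensor `J` with i.i.d. Bernoulli entries, one for each
`D`-subset of the vertices, with values in `{0, 1} ⊂ ℝ`. -/
def diluted (D n : ℕ) (d : ℝ) : Measure (Hyperedge n D → ℝ) :=
  Measure.pi fun _ => bernoulliMeasure (1 : ℝ) 0 (edgeProb D n d)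

/-- `E_{J ∼ Diluted(D, n, d)} ⟨Ψ(J, β, γ)| H[J] / n |Ψ(J, β, γ)⟩`. -/
def expectedEnergy (D n : ℕ) (d β γ : ℝ) : ℂ :=
  ∫ J, braket (qaoaState (hamiltonian J) β γ) ((n : ℂ)⁻¹ • hamiltonian J) ∂(diluted D n d)

/-- Bitstrings of length 3. Addition is bitwise XOR. -/
abbrev Bits : Type := Fin 3 → ZMod 2

/-- The bitstring written `s₂s₁s₀`; its entry at index `j` is `s_j`. -/
def bits (s₂ s₁ s₀ : ZMod 2) : Bits := ![s₀, s₁, s₂]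

/-- The sign `(-1)^b` of a bit. -/
def bitSign (b : ZMod 2) : ℂ := (-1) ^ b.val

/-- The set `𝓛` of odd bitstrings, those with `s₀ ≠ s₁`. -/
def oddBits : Finset Bits := Finset.univ.filter fun s => s 0 ≠ s 1

/-- `B_{β, s}`, the product of `cos (β/2)` for each of the pairs `(s₀, s₁)`, `(s₂, s₁)` of equal
bits and of `i sin (β/2)` for each of them of distinct bits. -/
def mixerWeight (β : ℝ) (s : Bits) : ℂ :=
  ((Real.cos (β / 2) : ℝ) : ℂ) ^ ((if s 0 = s 1 then 1 else 0) + (if s 2 = s 1 then 1 else 0)) *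
    (Complex.I * ((Real.sin (β / 2) : ℝ) : ℂ)) ^
      ((if s 0 ≠ s 1 then 1 else 0) + (if s 2 ≠ s 1 then 1 else 0))

/-- `φ(γ, s) = (γ/2) ((-1)^{s₂} - (-1)^{s₀})`. -/
def phase (γ : ℝ) (s : Bits) : ℂ := ((γ / 2 : ℝ) : ℂ) * (bitSign (s 2) - bitSign (s 0))

/-- `⊕_s s^{⊕ D_s}`, the XOR of the bitstrings `s` with `D_s` odd. -/
def xorPow (Ds : Bits → ℕ) : Bits := ∑ s ∈ Finset.univ.filter (fun s => Odd (Ds s)), s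

end DilutedSpin

end

/-! Conjugation by the mixer turns `Z_S` into a product over the qubits of `S` of one-qubit matrices
(`mixer_conj_opZ`). Hence `⟨Z_S⟩` is a sum over basis states `x` and flip patterns `δ`, where only
`δ` supported on `S` matter, and each hyperedge `T` enters through a phase `e^{iγ w J_T}`. Here `w ∈
{0, 1, -1}` is nonzero exactly when `T` meets the support of `δ` in an odd number of vertices
(`braket_qaoaState_opZ`). Independence of the `J_T` turns the mean of these phases into a product of
Bernoulli characteristic functions (`expectedEnergy_eq`).

For fixed `δ`, let `N` be the number of hyperedges `T ≠ S` with `w ≠ 0`, and `W` the sum of the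
signs `w` over them. The product is close to `exp(-pN(1 - cos γ) + i pW sin γ)`. Each vertex has
mean degree exactly `d` and mean codegrees vanish, so `pN` tends to `d` times the number of flipped
qubits. Parities of distinct hyperedges are orthogonal, so `|W|` averages to at most `√N` over `x`,
and `p√N = √(pN) √p` vanishes. Each flipped qubit therefore costs a factor `e^{-d(1 - cos γ)}`
(`sum_norm_prod_edgeFactor_sub_le`).

What remains couples the qubits of `S` only through the phase of `S` itself. Euler's formula splits
that phase into four products over qubits, so the sum becomes a combination of `D`-th powers of a
one-qubit quantity (`sum_sum_damped`). That quantity is a sum over the strings `s₂s₁s₀`, with `s₂`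
and `s₀` the bra and ket bits and `s₁` the bit read by `Z` (`sum_bitsWeight`). The multinomial
theorem expands its powers into the stated formula (`limitWeight_eq_sum_piAntidiag`). -/

noncomputable section

namespace DilutedSpin

/-! ### Parities and tensor products of one-qubit operators. -/

/-- The eigenvalue `±1` of Pauli Z on a computational basis state. -/
def spin (a : Fin 2) : ℝ := if a = 0 then 1 else -1

/-- The eigenvalue of `∏_{k ∈ T} Z_k` on the basis state `x`. -/
def parity {n : ℕ} (T : Finset (Fin n)) (x : Fin n → Fin 2) : ℝ := ∏ k ∈ T, spin (x k)

@[simp] lemma spin_zero : spin 0 = 1 := by simp [spin]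

@[simp] lemma spin_one : spin 1 = -1 := by simp [spin]

lemma spin_add (a b : Fin 2) : spin (a + b) = spin a * spin b := by
  fin_cases a <;> fin_cases b <;> simp [spin]

lemma spin_mul_self (a : Fin 2) : spin a * spin a = 1 := by
  fin_cases a <;> simp [spin]

lemma parity_add {n : ℕ} (T : Finset (Fin n)) (x y : Fin n → Fin 2) :
    parity T (x + y) = parity T x * parity T y := by
  simp [parity, spin_add, Finset.prod_mul_distrib]

lemma parity_mul_self {n : ℕ} (T : Finset (Fin n)) (x : Fin n → Fin 2) :
    parity T x * parity T x = 1 := by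
  simp [parity, ← Finset.prod_mul_distrib, spin_mul_self]

lemma parity_eq_or {n : ℕ} (T : Finset (Fin n)) (x : Fin n → Fin 2) :
    parity T x = 1 ∨ parity T x = -1 :=
  mul_self_eq_one_iff.1 (parity_mul_self T x)

lemma tensorOp_mul {n : ℕ} (A B : Fin n → Matrix (Fin 2) (Fin 2) ℂ) :
    tensorOp A * tensorOp B = tensorOp fun k => A k * B k := by
  ext x y
  simp only [tensorOp, Matrix.mul_apply, ← Finset.prod_mul_distrib]
  exact (Fintype.prod_sum fun k b => A k (x k) b * B k b (y k)).symm

lemma tensorOp_diagonal {n : ℕ} (f : Fin n → Fin 2 → ℂ) :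
    tensorOp (fun k => diagonal (f k)) = diagonal fun x => ∏ k, f k (x k) := by
  ext x y
  by_cases h : x = y
  · subst h; simp [tensorOp]
  · obtain ⟨k, hk⟩ := Function.ne_iff.1 h
    rw [diagonal_apply_ne _ h]
    exact Finset.prod_eq_zero (Finset.mem_univ k) (diagonal_apply_ne _ hk)

lemma tensorOp_one {n : ℕ} : tensorOp (fun _ : Fin n => 1) = 1 := by
  simpa [← diagonal_one] using tensorOp_diagonal (fun (_ : Fin n) _ => 1)

lemma tensorOp_conjTranspose {n : ℕ} (A : Fin n → Matrix (Fin 2) (Fin 2) ℂ) :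
    (tensorOp A)ᴴ = tensorOp fun k => (A k)ᴴ := by
  ext x y
  simp [tensorOp, conjTranspose_apply]

lemma pauliZ_eq_diagonal : pauliZ = diagonal fun a => (spin a : ℂ) := by
  ext a b
  fin_cases a <;> fin_cases b <;> simp [pauliZ]

lemma opZ_eq_diagonal {n : ℕ} (S : Finset (Fin n)) :
    opZ S = diagonal fun x => (parity S x : ℂ) := by
  have h : (fun j => if j ∈ S then pauliZ else 1) =
      fun j : Fin n => diagonal fun a => if j ∈ S then (spin a : ℂ) else 1 := by
    funext j
    split_ifs
    · exact pauliZ_eq_diagonal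
    · exact diagonal_one.symm
  rw [opZ, h, tensorOp_diagonal]
  simp [parity, Finset.prod_ite_mem]

/-! ### The mixer and its Heisenberg picture. -/

/-- The unnormalized Hadamard matrix. -/
def hadamard : Matrix (Fin 2) (Fin 2) ℂ := !![1, 1; 1, -1]

lemma hadamard_mul_half : hadamard * ((2 : ℂ)⁻¹ • hadamard) = 1 := by
  ext a b
  fin_cases a <;> fin_cases b <;> norm_num [hadamard, Matrix.mul_apply, Fin.sum_univ_two]

lemma hadamard_conj_pauliZ : hadamard * pauliZ * ((2 : ℂ)⁻¹ • hadamard) = pauliX := by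
  ext a b
  fin_cases a <;> fin_cases b <;>
    norm_num [hadamard, pauliX, pauliZ, Matrix.mul_apply, Fin.sum_univ_two]

/-- The single-qubit rotation `e^{-i(β/2) X}`. -/
def mixerGate (β : ℝ) : Matrix (Fin 2) (Fin 2) ℂ :=
  !![(Real.cos (β / 2) : ℂ), -(Complex.I * Real.sin (β / 2));
    -(Complex.I * Real.sin (β / 2)), (Real.cos (β / 2) : ℂ)]

lemma hadamard_conj_diagonal (β : ℝ) :
    hadamard * diagonal (fun a => Complex.exp (-(Complex.I * ((β / 2 : ℝ) : ℂ)) * spin a)) *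
      ((2 : ℂ)⁻¹ • hadamard) = mixerGate β := by
  have h1 : Complex.exp (-(Complex.I * ((β / 2 : ℝ) : ℂ))) =
      Real.cos (β / 2) - Complex.I * Real.sin (β / 2) := by
    rw [show -(Complex.I * ((β / 2 : ℝ) : ℂ)) = ((-(β / 2) : ℝ) : ℂ) * Complex.I by push_cast; ring,
      Complex.exp_mul_I, ← Complex.ofReal_cos, ← Complex.ofReal_sin]
    rw [Real.cos_neg, Real.sin_neg]; push_cast; ring
  have h2 : Complex.exp (Complex.I * ((β / 2 : ℝ) : ℂ)) =
      Real.cos (β / 2) + Complex.I * Real.sin (β / 2) := by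
    rw [mul_comm, Complex.exp_mul_I, ← Complex.ofReal_cos, ← Complex.ofReal_sin]
    ring
  have hd : diagonal (fun a => Complex.exp (-(Complex.I * ((β / 2 : ℝ) : ℂ)) * spin a)) =
      !![(Real.cos (β / 2) : ℂ) - Complex.I * Real.sin (β / 2), 0;
        0, Real.cos (β / 2) + Complex.I * Real.sin (β / 2)] := by
    rw [← h1, ← h2]
    ext a b
    fin_cases a <;> fin_cases b <;> simp
  rw [hd, mixerGate]
  generalize (Real.cos (β / 2) : ℂ) = c
  generalize (Real.sin (β / 2) : ℂ) = s
  ext a b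
  fin_cases a <;> fin_cases b <;>
    simp [hadamard, Matrix.mul_apply, Fin.sum_univ_two] <;> ring

/-- Hadamard matrices on all qubits diagonalize every `X_k` at once; the exponential of the
resulting sum of spins is a product over qubits. -/
lemma exp_mixer (n : ℕ) (β : ℝ) :
    NormedSpace.exp ((-(Complex.I * ((β / 2 : ℝ) : ℂ))) • mixer n) =
      tensorOp fun _ => mixerGate β := by
  set c : ℂ := -(Complex.I * ((β / 2 : ℝ) : ℂ)) with hc
  set G : QubitOp n := tensorOp fun _ => hadamard with hG
  set G' : QubitOp n := tensorOp fun _ => (2 : ℂ)⁻¹ • hadamard with hG'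
  have hGG : G * G' = 1 := by
    rw [hG, hG', tensorOp_mul]
    simp only [hadamard_mul_half, tensorOp_one]
  have hinv : G⁻¹ = G' := Matrix.inv_eq_right_inv hGG
  have hunit : IsUnit G := by
    rw [Matrix.isUnit_iff_isUnit_det]
    exact Matrix.isUnit_det_of_right_inverse hGG
  have hX (k : Fin n) : opX k = G * opZ {k} * G' := by
    rw [hG, hG', opZ, tensorOp_mul, tensorOp_mul, opX]
    congr 1
    funext j
    by_cases hj : j = k
    · simp only [hj, Finset.mem_singleton, if_true, hadamard_conj_pauliZ]
    · simp only [hj, Finset.mem_singleton, if_false, mul_one, hadamard_mul_half]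
  have hmix : c • mixer n =
      G * diagonal (fun x => ∑ k, c * (spin (x k) : ℂ)) * G⁻¹ := by
    have hsum : (diagonal fun x : Fin n → Fin 2 => ∑ k, c * (spin (x k) : ℂ)) =
        c • ∑ k, opZ {k} := by
      ext x y
      by_cases h : x = y
      · subst h
        simp [opZ_eq_diagonal, parity, Matrix.sum_apply, Finset.mul_sum]
      · simp [opZ_eq_diagonal, Matrix.sum_apply, h]
    rw [hsum, hinv, mixer, Matrix.mul_smul, Matrix.smul_mul, Finset.mul_sum, Finset.sum_mul]
    simp only [hX]
  rw [hmix, Matrix.exp_conj _ _ hunit, Matrix.exp_diagonal, hinv]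
  have hd : diagonal (NormedSpace.exp fun x : Fin n → Fin 2 => ∑ k, c * (spin (x k) : ℂ)) =
      tensorOp fun _ : Fin n => diagonal fun a => Complex.exp (c * spin a) := by
    rw [tensorOp_diagonal]
    congr 1
    funext x
    rw [Pi.coe_exp, ← Complex.exp_eq_exp_ℂ, Complex.exp_sum]
  rw [hd, hG, hG', tensorOp_mul, tensorOp_mul]
  simp only [hc, hadamard_conj_diagonal]

/-- The single-qubit operator `e^{i(β/2)X} Z e^{-i(β/2)X} = (cos β) Z + (sin β) Y`. -/
def rotatedZ (β : ℝ) : Matrix (Fin 2) (Fin 2) ℂ :=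
  !![(Real.cos β : ℂ), -(Complex.I * Real.sin β); Complex.I * Real.sin β, -(Real.cos β : ℂ)]

lemma cos_eq_half (β : ℝ) : (Real.cos β : ℂ) =
    (Real.cos (β / 2) : ℂ) ^ 2 - (Real.sin (β / 2) : ℂ) ^ 2 := by
  have h : Real.cos β = Real.cos (β / 2) ^ 2 - Real.sin (β / 2) ^ 2 := by
    rw [← Real.cos_two_mul', mul_div_cancel₀ _ two_ne_zero]
  rw [h]; push_cast; ring

lemma sin_eq_half (β : ℝ) : (Real.sin β : ℂ) =
    2 * (Real.sin (β / 2) : ℂ) * (Real.cos (β / 2) : ℂ) := by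
  have h : Real.sin β = 2 * Real.sin (β / 2) * Real.cos (β / 2) := by
    rw [← Real.sin_two_mul, mul_div_cancel₀ _ two_ne_zero]
  rw [h]; push_cast; ring

lemma mixerGate_conj_pauliZ (β : ℝ) :
    (mixerGate β)ᴴ * pauliZ * mixerGate β = rotatedZ β := by
  ext a b
  fin_cases a <;> fin_cases b <;>
    simp [-Complex.ofReal_div, -Complex.ofReal_cos, -Complex.ofReal_sin,
      mixerGate, rotatedZ, pauliZ, Matrix.mul_apply, Fin.sum_univ_two, cos_eq_half β,
      sin_eq_half β] <;> ring_nf <;> simp <;> ring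

lemma mixerGate_unitary (β : ℝ) : (mixerGate β)ᴴ * mixerGate β = 1 := by
  have h : (Real.cos (β / 2) : ℂ) ^ 2 + (Real.sin (β / 2) : ℂ) ^ 2 = 1 := by
    exact_mod_cast Real.cos_sq_add_sin_sq (β / 2)
  ext a b
  fin_cases a <;> fin_cases b <;>
    simp [-Complex.ofReal_div, -Complex.ofReal_cos, -Complex.ofReal_sin,
      mixerGate, Matrix.mul_apply, Fin.sum_univ_two] <;>
      first
      | ring1
      | linear_combination h - (Real.sin (β / 2) : ℂ) ^ 2 * Complex.I_sq

/-- `∏_{k ∈ S} Z_k` in the Heisenberg picture of the mixer. -/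
def rotatedZs {n : ℕ} (β : ℝ) (S : Finset (Fin n)) : QubitOp n :=
  tensorOp fun k => if k ∈ S then rotatedZ β else 1

lemma mixer_conj_opZ {n : ℕ} (β : ℝ) (S : Finset (Fin n)) :
    (tensorOp fun _ => mixerGate β)ᴴ * opZ S * (tensorOp fun _ => mixerGate β) =
      rotatedZs β S := by
  rw [tensorOp_conjTranspose, opZ, tensorOp_mul, tensorOp_mul, rotatedZs]
  congr 1
  funext k
  split_ifs
  · exact mixerGate_conj_pauliZ β
  · rw [mul_one, mixerGate_unitary]

/-! ### Expectations as sums over basis states and flip patterns. -/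

/-- The eigenvalue of the problem Hamiltonian on a basis state. -/
def energy {n D : ℕ} (J : Hyperedge n D → ℝ) (x : Fin n → Fin 2) : ℝ :=
  ∑ T : Hyperedge n D, J T * parity T.1 x

lemma hamiltonian_eq_diagonal {n D : ℕ} (J : Hyperedge n D → ℝ) :
    hamiltonian J = diagonal fun x => (energy J x : ℂ) := by
  ext x y
  by_cases h : x = y
  · subst h
    simp [hamiltonian, energy, opZ_eq_diagonal, Matrix.sum_apply]
  · simp [hamiltonian, opZ_eq_diagonal, Matrix.sum_apply, h]

lemma phaseState_apply {n D : ℕ} (J : Hyperedge n D → ℝ) (γ : ℝ) (x : Fin n → Fin 2) :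
    (NormedSpace.exp ((-(Complex.I * ((γ / 2 : ℝ) : ℂ))) • hamiltonian J) *ᵥ plusState n) x =
      Complex.exp (-(Complex.I * ((γ / 2 : ℝ) : ℂ)) * energy J x) *
        ((Real.sqrt (2 ^ n) : ℝ) : ℂ)⁻¹ := by
  rw [hamiltonian_eq_diagonal, ← diagonal_smul, Matrix.exp_diagonal, mulVec_diagonal,
    Pi.coe_exp, ← Complex.exp_eq_exp_ℂ]
  rfl

lemma braket_mulVec {n : ℕ} (U A : QubitOp n) (φ : (Fin n → Fin 2) → ℂ) :
    braket (U *ᵥ φ) A = braket φ (Uᴴ * A * U) := by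
  simp only [braket, star_mulVec, ← dotProduct_mulVec, mulVec_mulVec, Matrix.mul_assoc]

/-- Addition in `Fin 2` is XOR. Indexing columns by the flip `δ` separates the two roles in a parity
difference: `δ` decides whether it vanishes, `x` its sign. -/
lemma braket_eq_sum {n : ℕ} (φ : (Fin n → Fin 2) → ℂ) (A : QubitOp n) :
    braket φ A = ∑ x, ∑ δ, A x (x + δ) * (star (φ x) * φ (x + δ)) := by
  simp only [braket, dotProduct, mulVec, Finset.mul_sum, Pi.star_apply]
  refine Finset.sum_congr rfl fun x _ => ?_
  rw [← Equiv.sum_comp (Equiv.addLeft x)]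
  refine Finset.sum_congr rfl fun δ _ => ?_
  simp only [Equiv.coe_addLeft]
  ring

/-- Half the change of `∏_{k ∈ T} Z_k` between the basis states `x` and `x + δ`. -/
def halfChange {n : ℕ} (T : Finset (Fin n)) (x δ : Fin n → Fin 2) : ℝ :=
  parity T x * ((1 - parity T δ) / 2)

lemma braket_qaoaState_opZ {n D : ℕ} (J : Hyperedge n D → ℝ) (β γ : ℝ) (S : Finset (Fin n)) :
    braket (qaoaState (hamiltonian J) β γ) (opZ S) =
      ∑ x, ∑ δ, (2 ^ n : ℂ)⁻¹ * rotatedZs β S x (x + δ) *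
        ∏ T : Hyperedge n D, Complex.exp (Complex.I * ((γ * halfChange T.1 x δ * J T : ℝ) : ℂ)) := by
  rw [qaoaState, exp_mixer, braket_mulVec, mixer_conj_opZ, braket_eq_sum]
  refine Finset.sum_congr rfl fun x _ => Finset.sum_congr rfl fun δ _ => ?_
  rw [phaseState_apply, phaseState_apply, ← Complex.exp_sum]
  have hs : ((Real.sqrt (2 ^ n) : ℝ) : ℂ)⁻¹ * ((Real.sqrt (2 ^ n) : ℝ) : ℂ)⁻¹ = (2 ^ n : ℂ)⁻¹ := by
    rw [← mul_inv, ← Complex.ofReal_mul, Real.mul_self_sqrt (by positivity)]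
    push_cast; rfl
  have he : ∑ T : Hyperedge n D, Complex.I * ((γ * halfChange T.1 x δ * J T : ℝ) : ℂ) =
      Complex.I * ((γ / 2 : ℝ) : ℂ) * energy J x +
        -(Complex.I * ((γ / 2 : ℝ) : ℂ)) * energy J (x + δ) := by
    have : γ / 2 * energy J x - γ / 2 * energy J (x + δ) =
        ∑ T : Hyperedge n D, γ * halfChange T.1 x δ * J T := by
      rw [energy, energy, Finset.mul_sum, Finset.mul_sum, ← Finset.sum_sub_distrib]
      refine Finset.sum_congr rfl fun T _ => ?_
      rw [parity_add, halfChange]; ring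
    rw [← Finset.mul_sum, ← Complex.ofReal_sum, ← this]
    push_cast; ring
  rw [he, Complex.exp_add, ← hs]
  have hstar : star (Complex.exp (-(Complex.I * ((γ / 2 : ℝ) : ℂ)) * energy J x)) =
      Complex.exp (Complex.I * ((γ / 2 : ℝ) : ℂ) * energy J x) := by
    rw [Complex.star_def, ← Complex.exp_conj]
    simp only [map_mul, map_neg, Complex.conj_I, Complex.conj_ofReal, neg_mul, neg_neg]
  rw [star_mul', hstar, star_inv₀, Complex.star_def, Complex.conj_ofReal]
  ring

lemma braket_sum_smul {n : ℕ} {ι : Type*} [Fintype ι] (ψ : (Fin n → Fin 2) → ℂ) (c : ℂ)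
    (a : ι → ℂ) (A : ι → QubitOp n) :
    braket ψ (c • ∑ i, a i • A i) = c * ∑ i, a i * braket ψ (A i) := by
  simp [braket, smul_mulVec, sum_mulVec, dotProduct_sum, dotProduct_smul]

/-! ### Poisson approximation of products of Bernoulli characteristic functions. -/

lemma norm_prod_sub_prod_le_sum {ι : Type*} (s : Finset ι) (u v : ι → ℂ)
    (hu : ∀ i ∈ s, ‖u i‖ ≤ 1) (hv : ∀ i ∈ s, ‖v i‖ ≤ 1) :
    ‖∏ i ∈ s, u i - ∏ i ∈ s, v i‖ ≤ ∑ i ∈ s, ‖u i - v i‖ := by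
  classical
  induction s using Finset.induction_on with
  | empty => simp
  | insert a s ha ih =>
    rw [Finset.prod_insert ha, Finset.prod_insert ha, Finset.sum_insert ha]
    have h1 := ih (fun i hi => hu i (Finset.mem_insert_of_mem hi))
      (fun i hi => hv i (Finset.mem_insert_of_mem hi))
    have h2 : ‖∏ i ∈ s, v i‖ ≤ 1 := by
      rw [norm_prod]
      exact Finset.prod_le_one (fun _ _ => norm_nonneg _)
        fun i hi => hv i (Finset.mem_insert_of_mem hi)
    have h3 := hu a (Finset.mem_insert_self a s)
    calc ‖u a * ∏ i ∈ s, u i - v a * ∏ i ∈ s, v i‖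
        = ‖(u a - v a) * ∏ i ∈ s, v i + u a * (∏ i ∈ s, u i - ∏ i ∈ s, v i)‖ := by
          congr 1; ring
      _ ≤ ‖u a - v a‖ * ‖∏ i ∈ s, v i‖ + ‖u a‖ * ‖∏ i ∈ s, u i - ∏ i ∈ s, v i‖ := by
          rw [← norm_mul, ← norm_mul]; exact norm_add_le _ _
      _ ≤ ‖u a - v a‖ * 1 + 1 * ‖∏ i ∈ s, u i - ∏ i ∈ s, v i‖ := by gcongr
      _ ≤ _ := by linarith

lemma norm_exp_I_mul_ofReal_eq_one (t : ℝ) : ‖Complex.exp (Complex.I * t)‖ = 1 := by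
  rw [mul_comm, Complex.norm_exp_ofReal_mul_I]

lemma norm_exp_of_re_nonpos {z : ℂ} (hz : z.re ≤ 0) : ‖Complex.exp z‖ ≤ 1 := by
  rw [Complex.norm_exp]
  exact Real.exp_le_one_iff.2 hz

lemma re_exp_I_mul_sub_one_nonpos (t : ℝ) : (Complex.exp (Complex.I * t) - 1).re ≤ 0 := by
  have h := Complex.re_le_norm (Complex.exp (Complex.I * t))
  rw [norm_exp_I_mul_ofReal_eq_one] at h
  simpa using h

/-- `E e^{iγwJ}` for a Bernoulli variable `J` of parameter `p`. -/
def edgeFactor (p γ w : ℝ) : ℂ := 1 + p * (Complex.exp (Complex.I * ((γ * w : ℝ) : ℂ)) - 1)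

lemma norm_edgeFactor_le {p : ℝ} (hp0 : 0 ≤ p) (hp1 : p ≤ 1) (γ w : ℝ) :
    ‖edgeFactor p γ w‖ ≤ 1 := by
  have h : edgeFactor p γ w =
      ((1 - p : ℝ) : ℂ) + (p : ℂ) * Complex.exp (Complex.I * ((γ * w : ℝ) : ℂ)) := by
    rw [edgeFactor]; push_cast; ring
  rw [h]
  refine (norm_add_le _ _).trans ?_
  rw [norm_mul, norm_exp_I_mul_ofReal_eq_one, Complex.norm_real, Complex.norm_real,
    Real.norm_of_nonneg hp0, Real.norm_of_nonneg (by linarith)]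
  linarith

/-- Cosine is even and sine odd, so on `{0, 1, -1}` the damping depends on `w ^ 2` and the phase is
linear in `w`. -/
lemma exp_I_mul_sub_one_eq (γ : ℝ) {w : ℝ} (hw : w = 0 ∨ w = 1 ∨ w = -1) :
    Complex.exp (Complex.I * ((γ * w : ℝ) : ℂ)) - 1 =
      ((-(1 - Real.cos γ) * w ^ 2 : ℝ) : ℂ) + Complex.I * ((Real.sin γ * w : ℝ) : ℂ) := by
  rw [mul_comm, Complex.exp_mul_I, ← Complex.ofReal_cos, ← Complex.ofReal_sin]
  rcases hw with rfl | rfl | rfl <;> simp [-Complex.ofReal_cos, -Complex.ofReal_sin] <;> ring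

/-- Quadratic remainder of `exp` at `p z` with `‖p z‖ ≤ 2p ≤ 1`. The factor `w ^ 2` records that a
hyperedge with `w = 0` contributes no error. -/
lemma norm_edgeFactor_sub_exp_le {p : ℝ} (hp0 : 0 ≤ p) (hp1 : p ≤ 1 / 2) (γ : ℝ) {w : ℝ}
    (hw : w = 0 ∨ w = 1 ∨ w = -1) :
    ‖edgeFactor p γ w - Complex.exp (p * (Complex.exp (Complex.I * ((γ * w : ℝ) : ℂ)) - 1))‖ ≤
      4 * p ^ 2 * w ^ 2 := by
  set z := Complex.exp (Complex.I * ((γ * w : ℝ) : ℂ)) - 1 with hz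
  by_cases h0 : w = 0
  · simp [edgeFactor, hz, h0]
  have hw2 : w ^ 2 = 1 := by
    rcases hw with h | rfl | rfl
    · exact absurd h h0
    · norm_num
    · norm_num
  have hz2 : ‖z‖ ≤ 2 := by
    refine (norm_sub_le _ _).trans ?_
    rw [norm_exp_I_mul_ofReal_eq_one, norm_one]; norm_num
  have hpz : ‖(p : ℂ) * z‖ ≤ 2 * p := by
    rw [norm_mul, Complex.norm_real, Real.norm_of_nonneg hp0]
    nlinarith
  have h := Complex.norm_exp_sub_one_sub_id_le (hpz.trans (by linarith))
  rw [edgeFactor, norm_sub_rev, hw2, ← sub_sub]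
  refine h.trans ?_
  nlinarith [norm_nonneg ((p : ℂ) * z)]

lemma abs_exp_sub_exp_le {a b : ℝ} (ha : a ≤ 0) (hb : b ≤ 0) :
    |Real.exp a - Real.exp b| ≤ |a - b| := by
  wlog h : b ≤ a generalizing a b
  · rw [abs_sub_comm, abs_sub_comm a b]
    exact this hb ha (le_of_not_ge h)
  rw [abs_of_nonneg (sub_nonneg.2 (Real.exp_le_exp.2 h)), abs_of_nonneg (sub_nonneg.2 h)]
  have h1 := Real.add_one_le_exp (b - a)
  have h2 : Real.exp b = Real.exp a * Real.exp (b - a) := by rw [← Real.exp_add]; ring_nf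
  have h3 := Real.exp_le_one_iff.2 ha
  have h4 : Real.exp (b - a) ≤ 1 := Real.exp_le_one_iff.2 (by linarith)
  rw [h2]
  nlinarith [Real.exp_pos a]

/-- A product of Bernoulli characteristic functions is compared with the Poisson limit. -/
lemma norm_prod_edgeFactor_sub_le {ι : Type*} (s : Finset ι) (w : ι → ℝ)
    (hw : ∀ i, w i = 0 ∨ w i = 1 ∨ w i = -1) {p : ℝ} (hp0 : 0 ≤ p) (hp1 : p ≤ 1 / 2) (γ : ℝ)
    {r : ℝ} (hr : 0 ≤ r) :
    ‖∏ i ∈ s, edgeFactor p γ (w i) - ((Real.exp (-(r * (1 - Real.cos γ))) : ℝ) : ℂ)‖ ≤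
      4 * p ^ 2 * ∑ i ∈ s, w i ^ 2 + p * |∑ i ∈ s, w i| + 2 * |p * ∑ i ∈ s, w i ^ 2 - r| := by
  have hc0 : 0 ≤ 1 - Real.cos γ := by linarith [Real.cos_le_one γ]
  have hc2 : 1 - Real.cos γ ≤ 2 := by linarith [Real.neg_one_le_cos γ]
  set N := ∑ i ∈ s, w i ^ 2 with hN
  set W := ∑ i ∈ s, w i with hW
  have hN0 : 0 ≤ N := Finset.sum_nonneg fun i _ => sq_nonneg _
  set v : ι → ℂ := fun i =>
    Complex.exp (p * (Complex.exp (Complex.I * ((γ * w i : ℝ) : ℂ)) - 1)) with hv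
  have hprod : ∏ i ∈ s, v i = ((Real.exp (-(p * N * (1 - Real.cos γ))) : ℝ) : ℂ) *
      Complex.exp (Complex.I * ((Real.sin γ * (p * W) : ℝ) : ℂ)) := by
    rw [hv, ← Complex.exp_sum, Complex.ofReal_exp, ← Complex.exp_add]
    congr 1
    simp_rw [exp_I_mul_sub_one_eq γ (hw _)]
    rw [← Finset.mul_sum, Finset.sum_add_distrib, ← Finset.mul_sum, ← Complex.ofReal_sum,
      ← Complex.ofReal_sum, ← Finset.mul_sum, ← Finset.mul_sum, ← hN, ← hW]
    push_cast; ring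
  -- Three errors: `h1` exponentiates the factors, `h2` drops the phase driven by `W`, `h3` replaces
  -- `p * N` by `r` in the damping, with `1 - cos γ ≤ 2`.
  have h1 : ‖∏ i ∈ s, edgeFactor p γ (w i) - ∏ i ∈ s, v i‖ ≤ 4 * p ^ 2 * N := by
    refine (norm_prod_sub_prod_le_sum s _ _ (fun i _ => norm_edgeFactor_le hp0 (by linarith) _ _)
      fun i _ => norm_exp_of_re_nonpos ?_).trans ?_
    · rw [Complex.re_ofReal_mul]
      exact mul_nonpos_of_nonneg_of_nonpos hp0 (re_exp_I_mul_sub_one_nonpos _)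
    · rw [hN, Finset.mul_sum]
      exact Finset.sum_le_sum fun i _ => norm_edgeFactor_sub_exp_le hp0 hp1 γ (hw i)
  have h2 : ‖∏ i ∈ s, v i - ((Real.exp (-(p * N * (1 - Real.cos γ))) : ℝ) : ℂ)‖ ≤ p * |W| := by
    rw [hprod, ← mul_sub_one, norm_mul, Complex.norm_real, Real.norm_of_nonneg (Real.exp_pos _).le]
    have e1 : Real.exp (-(p * N * (1 - Real.cos γ))) ≤ 1 :=
      Real.exp_le_one_iff.2 (neg_nonpos.2 (by positivity))
    have e2 := Real.norm_exp_I_mul_ofReal_sub_one_le (x := Real.sin γ * (p * W))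
    have e3 : ‖Real.sin γ * (p * W)‖ ≤ p * |W| := by
      rw [Real.norm_eq_abs, abs_mul, abs_mul, abs_of_nonneg hp0]
      exact mul_le_of_le_one_left (by positivity) (Real.abs_sin_le_one γ)
    calc _ ≤ 1 * (p * |W|) := by gcongr; exact e2.trans e3
      _ = _ := one_mul _
  have h3 : ‖((Real.exp (-(p * N * (1 - Real.cos γ))) : ℝ) : ℂ) -
      ((Real.exp (-(r * (1 - Real.cos γ))) : ℝ) : ℂ)‖ ≤ 2 * |p * N - r| := by
    rw [← Complex.ofReal_sub, Complex.norm_real, Real.norm_eq_abs]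
    refine (abs_exp_sub_exp_le (neg_nonpos.2 (by positivity))
      (neg_nonpos.2 (by positivity))).trans ?_
    rw [show -(p * N * (1 - Real.cos γ)) - -(r * (1 - Real.cos γ)) =
      (1 - Real.cos γ) * -(p * N - r) by ring, abs_mul, abs_neg, abs_of_nonneg hc0]
    gcongr
  calc _ = ‖(∏ i ∈ s, edgeFactor p γ (w i) - ∏ i ∈ s, v i) +
        (∏ i ∈ s, v i - ((Real.exp (-(p * N * (1 - Real.cos γ))) : ℝ) : ℂ)) +
        (((Real.exp (-(p * N * (1 - Real.cos γ))) : ℝ) : ℂ) -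
          ((Real.exp (-(r * (1 - Real.cos γ))) : ℝ) : ℂ))‖ := by congr 1; ring
    _ ≤ _ := (norm_add₃_le).trans (by linarith)

/-! ### Averaging over the random hypergraph. -/

/-- Absorbing `J S` into its own factor leaves a product of functions of single coordinates, as
integration against a product measure needs. -/
lemma edge_mul_prod_eq {n D : ℕ} (S : Hyperedge n D) (θ J : Hyperedge n D → ℝ) :
    ((J S : ℝ) : ℂ) * ∏ T, Complex.exp (Complex.I * ((θ T * J T : ℝ) : ℂ)) =
    ∏ T, (if T = S then ((J T : ℝ) : ℂ) else 1) *
      Complex.exp (Complex.I * ((θ T * J T : ℝ) : ℂ)) := by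
  rw [Finset.prod_mul_distrib, Finset.prod_ite_eq' Finset.univ S (fun T => ((J T : ℝ) : ℂ))]
  simp

lemma integral_edge_mul_prod (D n : ℕ) (d : ℝ) (S : Hyperedge n D) (θ : Hyperedge n D → ℝ) :
    ∫ J, ((J S : ℝ) : ℂ) * ∏ T, Complex.exp (Complex.I * ((θ T * J T : ℝ) : ℂ)) ∂(diluted D n d) =
      (edgeProb D n d : ℝ) * Complex.exp (Complex.I * θ S) *
        ∏ T ∈ Finset.univ.erase S, edgeFactor (edgeProb D n d) 1 (θ T) := by
  simp_rw [edge_mul_prod_eq, diluted]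
  rw [integral_fintype_prod_eq_prod (𝕜 := ℂ) (fun T (j : ℝ) => (if T = S then (j : ℂ) else 1) *
    Complex.exp (Complex.I * ((θ T * j : ℝ) : ℂ)))]
  simp_rw [integral_bernoulliMeasure]
  rw [← Finset.mul_prod_erase _ _ (Finset.mem_univ S)]
  congr 1
  · simp
  · refine Finset.prod_congr rfl fun T hT => ?_
    simp [Finset.ne_of_mem_erase hT, edgeFactor]
    ring

lemma integrable_edge_mul_prod (D n : ℕ) (d : ℝ) (S : Hyperedge n D) (θ : Hyperedge n D → ℝ) :
    Integrable (fun J : Hyperedge n D → ℝ => ((J S : ℝ) : ℂ) *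
      ∏ T, Complex.exp (Complex.I * ((θ T * J T : ℝ) : ℂ))) (diluted D n d) := by
  simp_rw [edge_mul_prod_eq, diluted]
  exact Integrable.fintype_prod (𝕜 := ℂ) (f := fun T (j : ℝ) => (if T = S then (j : ℂ) else 1) *
    Complex.exp (Complex.I * ((θ T * j : ℝ) : ℂ))) fun T => integrable_bernoulliMeasure _ _ _ _

/-- `E[J_S ⟨Z_S⟩] / P(J_S = 1)`, the mean of `⟨Z_S⟩` given that `S` is an edge. -/
def edgeEnergy (D n : ℕ) (p β γ : ℝ) (S : Hyperedge n D) : ℂ :=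
  ∑ x, ∑ δ, (2 ^ n : ℂ)⁻¹ * rotatedZs β S.1 x (x + δ) *
    (Complex.exp (Complex.I * ((γ * halfChange S.1 x δ : ℝ) : ℂ)) *
      ∏ T ∈ Finset.univ.erase S, edgeFactor p γ (halfChange T.1 x δ))

lemma expectedEnergy_eq (D n : ℕ) (d β γ : ℝ) :
    expectedEnergy D n d β γ = (n : ℂ)⁻¹ * ∑ S : Hyperedge n D,
      (edgeProb D n d : ℝ) * edgeEnergy D n (edgeProb D n d) β γ S := by
  have h (J : Hyperedge n D → ℝ) :
      braket (qaoaState (hamiltonian J) β γ) ((n : ℂ)⁻¹ • hamiltonian J) =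
      (n : ℂ)⁻¹ * ∑ S : Hyperedge n D, ∑ x, ∑ δ, (2 ^ n : ℂ)⁻¹ * rotatedZs β S.1 x (x + δ) *
        (((J S : ℝ) : ℂ) * ∏ T : Hyperedge n D,
          Complex.exp (Complex.I * ((γ * halfChange T.1 x δ * J T : ℝ) : ℂ))) := by
    conv_lhs => rw [show (n : ℂ)⁻¹ • hamiltonian J =
      (n : ℂ)⁻¹ • ∑ S : Hyperedge n D, (J S : ℂ) • opZ S.1 from rfl]
    rw [braket_sum_smul]
    congr 1
    refine Finset.sum_congr rfl fun S _ => ?_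
    rw [braket_qaoaState_opZ, Finset.mul_sum]
    refine Finset.sum_congr rfl fun x _ => ?_
    rw [Finset.mul_sum]
    refine Finset.sum_congr rfl fun δ _ => ?_
    ring
  have hi (S : Hyperedge n D) (x δ : Fin n → Fin 2) :=
    (integrable_edge_mul_prod D n d S fun T => γ * halfChange T.1 x δ).const_mul
      ((2 ^ n : ℂ)⁻¹ * rotatedZs β S.1 x (x + δ))
  rw [expectedEnergy]
  simp_rw [h]
  rw [integral_const_mul, integral_finsetSum _ fun S _ => integrable_finsetSum _ fun x _ =>
    integrable_finsetSum _ fun δ _ => hi S x δ]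
  congr 1
  refine Finset.sum_congr rfl fun S _ => ?_
  rw [integral_finsetSum _ fun x _ => integrable_finsetSum _ fun δ _ => hi S x δ, edgeEnergy,
    Finset.mul_sum]
  refine Finset.sum_congr rfl fun x _ => ?_
  rw [integral_finsetSum _ fun δ _ => hi S x δ, Finset.mul_sum]
  refine Finset.sum_congr rfl fun δ _ => ?_
  rw [integral_const_mul, integral_edge_mul_prod]
  simp only [edgeFactor, one_mul]
  ring

/-! ### Orthogonality of parities. -/

lemma sum_sum_prod {n : ℕ} {R : Type*} [CommSemiring R] (f : Fin n → Fin 2 → Fin 2 → R) :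
    ∑ x : Fin n → Fin 2, ∑ δ : Fin n → Fin 2, ∏ k, f k (x k) (δ k) =
      ∏ k, ∑ a, ∑ b, f k a b := by
  simp_rw [Fintype.prod_sum]

/-- The sum factors over qubits, and a qubit in exactly one of `S`, `T` contributes `1 + (-1) = 0`.
-/
lemma sum_parity_mul_parity {n : ℕ} (S T : Finset (Fin n)) :
    ∑ x, parity S x * parity T x = if S = T then 2 ^ n else 0 := by
  split_ifs with h
  · subst h
    simp [parity_mul_self]
  · have hp (x : Fin n → Fin 2) : parity S x * parity T x =
        ∏ k, ((if k ∈ S then spin (x k) else 1) * if k ∈ T then spin (x k) else 1) := by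
      rw [Finset.prod_mul_distrib, Finset.prod_ite_mem, Finset.prod_ite_mem, Finset.univ_inter,
        Finset.univ_inter, parity, parity]
    simp_rw [hp]
    rw [← Fintype.prod_sum fun k a =>
      (if k ∈ S then spin a else 1) * if k ∈ T then spin a else 1]
    obtain ⟨k, hk⟩ : ∃ k, ¬(k ∈ S ↔ k ∈ T) := by
      by_contra! hc
      exact h (Finset.ext hc)
    refine Finset.prod_eq_zero (Finset.mem_univ k) ?_
    by_cases h1 : k ∈ S <;> by_cases h2 : k ∈ T <;> simp_all

lemma halfChange_mem {n : ℕ} (T : Finset (Fin n)) (x δ : Fin n → Fin 2) :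
    halfChange T x δ = 0 ∨ halfChange T x δ = 1 ∨ halfChange T x δ = -1 := by
  rcases parity_eq_or T x with h | h <;> rcases parity_eq_or T δ with h' | h' <;>
    norm_num [halfChange, h, h']

/-- The indicator that `δ` has odd weight on `T`. -/
def oddOn {n : ℕ} (T : Finset (Fin n)) (δ : Fin n → Fin 2) : ℝ := (1 - parity T δ) / 2

lemma oddOn_sq {n : ℕ} (T : Finset (Fin n)) (δ : Fin n → Fin 2) :
    oddOn T δ ^ 2 = oddOn T δ := by
  rcases parity_eq_or T δ with h | h <;> norm_num [oddOn, h]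

lemma oddOn_nonneg {n : ℕ} (T : Finset (Fin n)) (δ : Fin n → Fin 2) : 0 ≤ oddOn T δ := by
  rw [← oddOn_sq]; positivity

lemma oddOn_le_one {n : ℕ} (T : Finset (Fin n)) (δ : Fin n → Fin 2) : oddOn T δ ≤ 1 := by
  rcases parity_eq_or T δ with h | h <;> norm_num [oddOn, h]

lemma halfChange_sq {n : ℕ} (T : Finset (Fin n)) (x δ : Fin n → Fin 2) :
    halfChange T x δ ^ 2 = oddOn T δ := by
  rw [halfChange, mul_pow, sq (parity T x), parity_mul_self, one_mul, ← oddOn, oddOn_sq]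

/-- The first moment of the parity sum, from the orthogonality of the parities. -/
lemma sum_abs_sum_halfChange_le {n D : ℕ} (s : Finset (Hyperedge n D)) (δ : Fin n → Fin 2) :
    ∑ x, |∑ T ∈ s, halfChange T.1 x δ| ≤ 2 ^ n * Real.sqrt (∑ T ∈ s, oddOn T.1 δ) := by
  have h2 : ∑ x, |∑ T ∈ s, halfChange T.1 x δ| ^ 2 = 2 ^ n * ∑ T ∈ s, oddOn T.1 δ := by
    have hx (x : Fin n → Fin 2) : |∑ T ∈ s, halfChange T.1 x δ| ^ 2 =
        ∑ T ∈ s, ∑ T' ∈ s, oddOn T.1 δ * oddOn T'.1 δ * (parity T.1 x * parity T'.1 x) := by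
      rw [sq_abs, sq, Finset.sum_mul_sum]
      refine Finset.sum_congr rfl fun T _ => Finset.sum_congr rfl fun T' _ => ?_
      rw [halfChange, halfChange, oddOn, oddOn]; ring
    simp_rw [hx]
    rw [Finset.sum_comm, Finset.mul_sum]
    refine Finset.sum_congr rfl fun T hT => ?_
    rw [Finset.sum_comm]
    simp_rw [← Finset.mul_sum, sum_parity_mul_parity, Subtype.coe_inj]
    simp only [mul_ite, mul_zero, Finset.sum_ite_eq, hT, if_true]
    rw [← sq, oddOn_sq, mul_comm]
  -- Cauchy–Schwarz over the `2 ^ n` basis states passes from the second moment to the first.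
  have h1 := sq_sum_le_card_mul_sum_sq (s := Finset.univ)
    (f := fun x : Fin n → Fin 2 => |∑ T ∈ s, halfChange T.1 x δ|)
  rw [h2] at h1
  simp only [Finset.card_univ, Fintype.card_fun, Fintype.card_fin] at h1
  rw [← Real.sqrt_sq (Finset.sum_nonneg fun x _ => abs_nonneg _)]
  refine (Real.sqrt_le_sqrt h1).trans ?_
  rw [← mul_assoc]
  push_cast
  rw [Real.sqrt_mul (by positivity), Real.sqrt_mul_self (by positivity)]

/-! ### Counting hyperedges that meet the support of a flip oddly. -/

/-- The qubits on which `δ` is nonzero. -/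
def supp {n : ℕ} (δ : Fin n → Fin 2) : Finset (Fin n) := Finset.univ.filter fun k => δ k ≠ 0

lemma parity_eq_pow {n : ℕ} (T : Finset (Fin n)) (δ : Fin n → Fin 2) :
    parity T δ = (-1) ^ (T ∩ supp δ).card := by
  have h : ∀ k ∈ T, spin (δ k) = if k ∈ supp δ then -1 else 1 := by
    intro k _
    by_cases hk : δ k = 0
    · simp [supp, hk]
    · simp [supp, spin, hk]
  rw [parity, Finset.prod_congr rfl h, Finset.prod_ite_mem, Finset.prod_const]

/-- With `j` common vertices, `j` and its parity bit agree for `j ≤ 1` and differ by at most `j(j -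
1)` otherwise. The error is thus charged to pairs of flipped vertices in one hyperedge. -/
lemma abs_oddOn_sub_card_le {n : ℕ} (T : Finset (Fin n)) (δ : Fin n → Fin 2) :
    |oddOn T δ - (T ∩ supp δ).card| ≤ (T ∩ supp δ).offDiag.card := by
  have hoff : ((T ∩ supp δ).offDiag.card : ℝ) =
      (T ∩ supp δ).card * (T ∩ supp δ).card - (T ∩ supp δ).card := by
    rw [Finset.offDiag_card, Nat.cast_sub (Nat.le_mul_self _), Nat.cast_mul]
  rw [hoff, oddOn, parity_eq_pow]
  generalize (T ∩ supp δ).card = j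
  rcases Nat.even_or_odd j with hj | hj
  · rw [hj.neg_one_pow, sub_self, zero_div, zero_sub, abs_neg, Nat.abs_cast]
    obtain ⟨m, rfl⟩ := hj
    rcases Nat.eq_zero_or_pos m with rfl | hm
    · simp
    · have : (1 : ℝ) ≤ m := by exact_mod_cast hm
      push_cast; nlinarith
  · rw [hj.neg_one_pow]
    have : (1 : ℝ) ≤ j := by exact_mod_cast hj.pos
    rw [abs_le]
    constructor <;> nlinarith

lemma card_hyperedge_filter {n D : ℕ} (A : Finset (Fin n)) (hA : A.card ≤ D) :
    (Finset.univ.filter fun T : Hyperedge n D => A ⊆ T.1).card =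
      (n - A.card).choose (D - A.card) := by
  have h := Finset.card_filter_powersetCard_subset A Finset.univ D (Finset.subset_univ A) hA
  rw [Finset.card_univ, Fintype.card_fin] at h
  rw [← h]
  refine Finset.card_bij (fun T _ => T.1) ?_ (fun T _ T' _ h => Subtype.ext h) ?_
  · intro T hT
    simpa [T.2] using hT
  · intro T hT
    simp only [Finset.mem_filter, Finset.mem_powersetCard_univ] at hT
    exact ⟨⟨T, hT.1⟩, by simpa using hT.2, rfl⟩

/-- Double counting of incidences between vertices of `Δ` and hyperedges; `sum_card_offDiag_inter`
does the same for ordered pairs. -/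
lemma sum_card_inter {n D : ℕ} (hD : 1 ≤ D) (Δ : Finset (Fin n)) :
    ∑ T : Hyperedge n D, (T.1 ∩ Δ).card = Δ.card * (n - 1).choose (D - 1) := by
  have h (T : Hyperedge n D) : (T.1 ∩ Δ).card = ∑ k ∈ Δ, if {k} ⊆ T.1 then 1 else 0 := by
    rw [Finset.inter_comm, ← Finset.filter_mem_eq_inter, Finset.card_filter]
    simp
  simp_rw [h]
  rw [Finset.sum_comm, ← smul_eq_mul, ← Finset.sum_const]
  refine Finset.sum_congr rfl fun k _ => ?_
  rw [← Finset.card_filter, card_hyperedge_filter _ (by simpa using hD), Finset.card_singleton]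

lemma sum_card_offDiag_inter {n D : ℕ} (hD : 2 ≤ D) (Δ : Finset (Fin n)) :
    ∑ T : Hyperedge n D, (T.1 ∩ Δ).offDiag.card = Δ.offDiag.card * (n - 2).choose (D - 2) := by
  have h (T : Hyperedge n D) : (T.1 ∩ Δ).offDiag.card =
      ∑ k ∈ Δ.offDiag, if {k.1, k.2} ⊆ T.1 then 1 else 0 := by
    rw [← Finset.card_filter]
    congr 1
    ext k
    simp only [Finset.mem_offDiag, Finset.mem_inter, Finset.mem_filter, Finset.insert_subset_iff,
      Finset.singleton_subset_iff]
    tauto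
  simp_rw [h]
  rw [Finset.sum_comm, ← smul_eq_mul, ← Finset.sum_const]
  refine Finset.sum_congr rfl fun k hk => ?_
  have hc := Finset.card_pair (Finset.mem_offDiag.1 hk).2.2
  rw [← Finset.card_filter, card_hyperedge_filter _ (by rw [hc]; exact hD), hc]

/-! ### Mean degrees and codegrees. -/

/-- The unclipped edge probability. -/
def rawProb (D n : ℕ) (d : ℝ) : ℝ := (n : ℝ) * d / ((D : ℝ) * (n.choose D : ℝ))

lemma rawProb_mul_choose {D n : ℕ} (hD : 1 ≤ D) (hn : D ≤ n) (d : ℝ) :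
    rawProb D n d * n.choose D = n * (d / D) := by
  have h1 : (n.choose D : ℝ) ≠ 0 := by exact_mod_cast (Nat.choose_pos hn).ne'
  have h2 : (D : ℝ) ≠ 0 := by exact_mod_cast (by omega : D ≠ 0)
  rw [rawProb]; field_simp

/-- The mean degree of a vertex, by the absorption identity `n C(n-1, D-1) = D C(n, D)`. -/
lemma rawProb_mul_choose_pred {D n : ℕ} (hD : 1 ≤ D) (hn : D ≤ n) (d : ℝ) :
    rawProb D n d * (n - 1).choose (D - 1) = d := by
  have h1 : (n.choose D : ℝ) ≠ 0 := by exact_mod_cast (Nat.choose_pos hn).ne'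
  have h2 : (D : ℝ) ≠ 0 := by exact_mod_cast (by omega : D ≠ 0)
  obtain ⟨m, rfl⟩ : ∃ m, n = m + 1 := ⟨n - 1, by omega⟩
  obtain ⟨E, rfl⟩ : ∃ E, D = E + 1 := ⟨D - 1, by omega⟩
  have h : ((m + 1 : ℕ) : ℝ) * m.choose E = (m + 1).choose (E + 1) * (E + 1 : ℕ) := by
    exact_mod_cast Nat.add_one_mul_choose_eq m E
  rw [rawProb, Nat.add_sub_cancel, Nat.add_sub_cancel, div_mul_eq_mul_div, div_eq_iff
    (mul_ne_zero h2 h1)]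
  linear_combination d * h

/-- The mean codegree of two vertices, of order `1 / n`: the reason why multiple intersections are
negligible. -/
lemma rawProb_mul_choose_pred_pred {D n : ℕ} (hD : 2 ≤ D) (hn : D ≤ n) (d : ℝ) :
    rawProb D n d * (n - 2).choose (D - 2) = d * ((D - 1 : ℕ) / (n - 1 : ℕ)) := by
  have h0 := rawProb_mul_choose_pred (by omega) hn d
  obtain ⟨m, rfl⟩ : ∃ m, n = m + 2 := ⟨n - 2, by omega⟩
  obtain ⟨E, rfl⟩ : ∃ E, D = E + 2 := ⟨D - 2, by omega⟩
  have h : ((m + 1 : ℕ) : ℝ) * m.choose E = (m + 1).choose (E + 1) * (E + 1 : ℕ) := by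
    exact_mod_cast Nat.add_one_mul_choose_eq m E
  have h3 : ((m + 1 : ℕ) : ℝ) ≠ 0 := by positivity
  simp only [Nat.add_sub_cancel, show m + 2 - 1 = m + 1 by omega,
    show E + 2 - 1 = E + 1 by omega] at h0 ⊢
  rw [← mul_div_assoc, eq_div_iff h3]
  linear_combination (rawProb (E + 2) (m + 2) d) * h + ((E + 1 : ℕ) : ℝ) * h0

lemma rawProb_nonneg {D n : ℕ} {d : ℝ} (hd : 0 ≤ d) : 0 ≤ rawProb D n d := by
  rw [rawProb]; positivity

/-- The error in the mean number of hyperedges that meet a set of at most `D` vertices in an odd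
number of vertices. -/
def degreeError (D n : ℕ) (d : ℝ) : ℝ :=
  D * D * (d * ((D - 1 : ℕ) / (n - 1 : ℕ))) + rawProb D n d

/-- The main term is a sum of mean degrees. The error has at most `D * D` codegrees, plus one `p`
for the omitted hyperedge `S`. -/
lemma abs_mean_oddOn_sub_le {D n : ℕ} (hD : 2 ≤ D) (hn : D ≤ n) {d : ℝ} (hd : 0 ≤ d)
    (S : Hyperedge n D) (δ : Fin n → Fin 2) (hδ : (supp δ).card ≤ D) :
    |rawProb D n d * ∑ T ∈ Finset.univ.erase S, oddOn T.1 δ - (supp δ).card * d| ≤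
      degreeError D n d := by
  set p := rawProb D n d with hp
  have hp0 : 0 ≤ p := rawProb_nonneg hd
  have hsum : |∑ T : Hyperedge n D, oddOn T.1 δ - (supp δ).card * (n - 1).choose (D - 1)| ≤
      (supp δ).offDiag.card * (n - 2).choose (D - 2) := by
    have e1 : ((supp δ).card * (n - 1).choose (D - 1) : ℝ) =
        ∑ T : Hyperedge n D, ((T.1 ∩ supp δ).card : ℝ) := by
      exact_mod_cast (sum_card_inter (by omega) (supp δ)).symm
    have e2 : ((supp δ).offDiag.card * (n - 2).choose (D - 2) : ℝ) =
        ∑ T : Hyperedge n D, ((T.1 ∩ supp δ).offDiag.card : ℝ) := by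
      exact_mod_cast (sum_card_offDiag_inter hD (supp δ)).symm
    rw [e1, e2, ← Finset.sum_sub_distrib]
    exact (Finset.abs_sum_le_sum_abs _ _).trans
      (Finset.sum_le_sum fun T _ => abs_oddOn_sub_card_le T.1 δ)
  have herase : ∑ T ∈ Finset.univ.erase S, oddOn T.1 δ =
      ∑ T : Hyperedge n D, oddOn T.1 δ - oddOn S.1 δ := by
    rw [← Finset.add_sum_erase _ _ (Finset.mem_univ S)]; ring
  have hoff : ((supp δ).offDiag.card : ℝ) ≤ D * D := by
    rw [Finset.offDiag_card]
    exact_mod_cast (Nat.sub_le _ _).trans (Nat.mul_le_mul hδ hδ)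
  have hd1 := rawProb_mul_choose_pred (by omega : 1 ≤ D) hn d
  have hd2 := rawProb_mul_choose_pred_pred hD hn d
  rw [herase, degreeError, ← hd2, ← hp]
  calc _ = |p * (∑ T : Hyperedge n D, oddOn T.1 δ - (supp δ).card * (n - 1).choose (D - 1)) +
        -(p * oddOn S.1 δ)| := by
          congr 1; linear_combination ((supp δ).card : ℝ) * hd1
    _ ≤ p * |∑ T : Hyperedge n D, oddOn T.1 δ - (supp δ).card * (n - 1).choose (D - 1)| +
        p * oddOn S.1 δ := by
          refine (abs_add_le _ _).trans ?_
          rw [abs_mul, abs_of_nonneg hp0, abs_neg, abs_of_nonneg (mul_nonneg hp0 (oddOn_nonneg _ _))]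
    _ ≤ p * ((D * D) * (n - 2).choose (D - 2)) + p * 1 := by
          gcongr
          · exact hsum.trans (by gcongr)
          · exact oddOn_le_one _ _
    _ = _ := by ring

/-! ### The Poisson limit averaged over basis states. -/

/-- The bound on the error of the Poisson limit, averaged over the bitstrings. -/
def poissonError (D n : ℕ) (d : ℝ) : ℝ :=
  4 * rawProb D n d * (D * d + degreeError D n d) +
    Real.sqrt (D * d + degreeError D n d) * Real.sqrt (rawProb D n d) +
    2 * degreeError D n d

lemma sum_norm_prod_edgeFactor_sub_le {D n : ℕ} (hD : 2 ≤ D) (hn : D ≤ n) {d : ℝ} (hd : 0 ≤ d)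
    (hp : rawProb D n d ≤ 1 / 2) (γ : ℝ) (S : Hyperedge n D) (δ : Fin n → Fin 2)
    (hδ : (supp δ).card ≤ D) :
    ∑ x, ‖∏ T ∈ Finset.univ.erase S, edgeFactor (rawProb D n d) γ (halfChange T.1 x δ) -
      ((Real.exp (-((supp δ).card * d * (1 - Real.cos γ))) : ℝ) : ℂ)‖ ≤
      2 ^ n * poissonError D n d := by
  set p := rawProb D n d with hpdef
  have hp0 : 0 ≤ p := rawProb_nonneg hd
  set N := ∑ T ∈ Finset.univ.erase S, oddOn T.1 δ with hN
  have hN0 : 0 ≤ N := Finset.sum_nonneg fun T _ => oddOn_nonneg _ _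
  have hE := abs_mean_oddOn_sub_le hD hn hd S δ hδ
  rw [← hpdef, ← hN] at hE
  have hpN : p * N ≤ D * d + degreeError D n d := by
    have h1 : ((supp δ).card : ℝ) * d ≤ D * d := by gcongr
    linarith [(abs_le.1 hE).2]
  have hx (x : Fin n → Fin 2) := norm_prod_edgeFactor_sub_le (Finset.univ.erase S)
    (fun T : Hyperedge n D => halfChange T.1 x δ) (fun T => halfChange_mem T.1 x δ) hp0 hp γ
    (r := (supp δ).card * d) (by positivity)
  simp_rw [halfChange_sq, ← hN] at hx
  refine (Finset.sum_le_sum fun x _ => hx x).trans ?_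
  rw [Finset.sum_add_distrib, Finset.sum_add_distrib]
  simp only [Finset.sum_const, Finset.card_univ, Fintype.card_fun, Fintype.card_fin, nsmul_eq_mul]
  push_cast
  have h2 := sum_abs_sum_halfChange_le (Finset.univ.erase S) δ
  rw [← hN] at h2
  -- Since `p * N` stays bounded, the random phase is only of order `√p`.
  have h3 : p * Real.sqrt N ≤ Real.sqrt (D * d + degreeError D n d) * Real.sqrt p := by
    calc p * Real.sqrt N = Real.sqrt (p * N) * Real.sqrt p := by
          rw [Real.sqrt_mul hp0]
          nth_rewrite 1 [← Real.mul_self_sqrt hp0]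
          ring
      _ ≤ _ := by gcongr
  have h4 : 4 * p ^ 2 * N ≤ 4 * p * (D * d + degreeError D n d) := by nlinarith
  calc _ ≤ 2 ^ n * (4 * p * (D * d + degreeError D n d)) +
        p * (2 ^ n * Real.sqrt N) + 2 ^ n * (2 * degreeError D n d) := by
          rw [← Finset.mul_sum]
          refine add_le_add_three ?_ ?_ ?_ <;> gcongr
    _ = 2 ^ n * (4 * p * (D * d + degreeError D n d) + p * Real.sqrt N +
        2 * degreeError D n d) := by ring
    _ ≤ _ := by rw [poissonError]; gcongr

/-! ### Factorization of the limit over qubits. -/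

/-- The coefficients of `e^{iθP} = cos θ + i (sin θ) P` for a sign `P`. -/
def eulerCoeff (θ : ℝ) (ε : Fin 2) : ℂ := if ε = 0 then (Real.cos θ : ℂ) else Complex.I * Real.sin θ

lemma exp_I_mul_sign (θ : ℝ) {P : ℂ} (hP : P = 1 ∨ P = -1) :
    Complex.exp (Complex.I * (θ * P)) = ∑ ε : Fin 2, eulerCoeff θ ε * P ^ (ε : ℕ) := by
  rcases hP with rfl | rfl
  · rw [mul_one, mul_comm, Complex.exp_mul_I, Fin.sum_univ_two]
    simp [eulerCoeff]; ring
  · rw [mul_comm, mul_neg_one, Complex.exp_mul_I, Fin.sum_univ_two]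
    simp [eulerCoeff]; ring

/-- The damping factor of a qubit flip in the Poisson limit. -/
def damping (d γ : ℝ) : ℝ := Real.exp (-(d * (1 - Real.cos γ)))

lemma exp_neg_nat_mul (d γ : ℝ) (m : ℕ) :
    Real.exp (-(m * d * (1 - Real.cos γ))) = damping d γ ^ m := by
  rw [damping, ← Real.exp_nat_mul]; congr 1; ring

/-- The contribution of one qubit of a hyperedge. -/
def qubitWeight (d β γ : ℝ) (ε ε' : Fin 2) : ℂ :=
  ∑ a : Fin 2, ∑ b : Fin 2, rotatedZ β a (a + b) * (spin a : ℂ) ^ (ε : ℕ) *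
    (spin (a + b) : ℂ) ^ (ε' : ℕ) * if b ≠ 0 then (damping d γ : ℂ) else 1

/-- The limit of `2^D` times the mean of `⟨Z_S⟩` given that `S` is an edge. -/
def limitWeight (D : ℕ) (d β γ : ℝ) : ℂ :=
  ∑ ε : Fin 2, ∑ ε' : Fin 2,
    eulerCoeff (γ / 2) ε * eulerCoeff (-(γ / 2)) ε' * qubitWeight d β γ ε ε' ^ D

/-- Every factor is a product over qubits. Off `S` the identity matrix forces no flip and the two
basis values cancel the `1/2`; each of the `D` qubits of `S` gives `qubitWeight / 2`. -/
lemma sum_sum_qubits {n D : ℕ} (S : Hyperedge n D) (d β γ : ℝ) (ε ε' : Fin 2) :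
    ∑ x, ∑ δ, (2 ^ n : ℂ)⁻¹ * rotatedZs β S.1 x (x + δ) * (parity S.1 x : ℂ) ^ (ε : ℕ) *
      (parity S.1 (x + δ) : ℂ) ^ (ε' : ℕ) * (damping d γ : ℂ) ^ (supp δ).card =
      (2 ^ D : ℂ)⁻¹ * qubitWeight d β γ ε ε' ^ D := by
  have hpar (x : Fin n → Fin 2) (e : ℕ) : (parity S.1 x : ℂ) ^ e =
      ∏ k, if k ∈ S.1 then (spin (x k) : ℂ) ^ e else 1 := by
    rw [Finset.prod_ite_mem, Finset.univ_inter, parity, Complex.ofReal_prod, Finset.prod_pow]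
  have hterm (x δ : Fin n → Fin 2) :
      (2 ^ n : ℂ)⁻¹ * rotatedZs β S.1 x (x + δ) * (parity S.1 x : ℂ) ^ (ε : ℕ) *
      (parity S.1 (x + δ) : ℂ) ^ (ε' : ℕ) * (damping d γ : ℂ) ^ (supp δ).card =
      ∏ k, (2 : ℂ)⁻¹ * (if k ∈ S.1 then rotatedZ β else 1) (x k) (x k + δ k) *
        (if k ∈ S.1 then (spin (x k) : ℂ) ^ (ε : ℕ) else 1) *
        (if k ∈ S.1 then (spin (x k + δ k) : ℂ) ^ (ε' : ℕ) else 1) *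
        (if δ k ≠ 0 then (damping d γ : ℂ) else 1) := by
    simp only [Finset.prod_mul_distrib, Finset.prod_const, Finset.card_univ, Fintype.card_fin,
      inv_pow]
    rw [hpar, hpar, ← Finset.prod_filter (fun k => δ k ≠ 0), Finset.prod_const]
    rfl
  simp_rw [hterm]
  rw [sum_sum_prod fun k a b => (2 : ℂ)⁻¹ * (if k ∈ S.1 then rotatedZ β else 1) a (a + b) *
        (if k ∈ S.1 then (spin a : ℂ) ^ (ε : ℕ) else 1) *
        (if k ∈ S.1 then (spin (a + b) : ℂ) ^ (ε' : ℕ) else 1) *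
        (if b ≠ 0 then (damping d γ : ℂ) else 1)]
  have hk (k : Fin n) : (∑ a : Fin 2, ∑ b : Fin 2,
      (2 : ℂ)⁻¹ * (if k ∈ S.1 then rotatedZ β else 1) a (a + b) *
        (if k ∈ S.1 then (spin a : ℂ) ^ (ε : ℕ) else 1) *
        (if k ∈ S.1 then (spin (a + b) : ℂ) ^ (ε' : ℕ) else 1) *
        (if b ≠ 0 then (damping d γ : ℂ) else 1)) =
      if k ∈ S.1 then (2 : ℂ)⁻¹ * qubitWeight d β γ ε ε' else 1 := by
    split_ifs with h
    · simp only [qubitWeight, Finset.mul_sum, mul_assoc]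
    · norm_num [Fin.sum_univ_two, Matrix.one_apply]
  simp_rw [hk]
  rw [Finset.prod_ite_mem, Finset.univ_inter, Finset.prod_const, S.2, mul_pow, inv_pow]

/-- The half change is half the difference of the parities at `x` and `x + δ`. Euler's formula for
each makes the phase a combination of products over qubits. -/
lemma exp_halfChange {n : ℕ} (S : Finset (Fin n)) (γ : ℝ) (x δ : Fin n → Fin 2) :
    Complex.exp (Complex.I * ((γ * halfChange S x δ : ℝ) : ℂ)) =
      ∑ ε : Fin 2, ∑ ε' : Fin 2, eulerCoeff (γ / 2) ε * eulerCoeff (-(γ / 2)) ε' *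
        ((parity S x : ℂ) ^ (ε : ℕ) * (parity S (x + δ) : ℂ) ^ (ε' : ℕ)) := by
  have hsign (y : Fin n → Fin 2) : (parity S y : ℂ) = 1 ∨ (parity S y : ℂ) = -1 := by
    exact_mod_cast parity_eq_or S y
  have h : Complex.I * ((γ * halfChange S x δ : ℝ) : ℂ) =
      Complex.I * (((γ / 2 : ℝ) : ℂ) * parity S x) +
        Complex.I * (((-(γ / 2) : ℝ) : ℂ) * parity S (x + δ)) := by
    rw [parity_add, halfChange]; push_cast; ring
  rw [h, Complex.exp_add, exp_I_mul_sign _ (hsign x), exp_I_mul_sign _ (hsign (x + δ)),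
    Finset.sum_mul_sum]
  refine Finset.sum_congr rfl fun ε _ => Finset.sum_congr rfl fun ε' _ => ?_
  ring

lemma sum_sum_damped {n D : ℕ} (S : Hyperedge n D) (d β γ : ℝ) :
    ∑ x, ∑ δ, (2 ^ n : ℂ)⁻¹ * rotatedZs β S.1 x (x + δ) *
      (Complex.exp (Complex.I * ((γ * halfChange S.1 x δ : ℝ) : ℂ)) *
        ((Real.exp (-((supp δ).card * d * (1 - Real.cos γ))) : ℝ) : ℂ)) =
      (2 ^ D : ℂ)⁻¹ * limitWeight D d β γ := by
  have h (x δ : Fin n → Fin 2) : (2 ^ n : ℂ)⁻¹ * rotatedZs β S.1 x (x + δ) *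
      (Complex.exp (Complex.I * ((γ * halfChange S.1 x δ : ℝ) : ℂ)) *
        ((Real.exp (-((supp δ).card * d * (1 - Real.cos γ))) : ℝ) : ℂ)) =
      ∑ ε : Fin 2, ∑ ε' : Fin 2, eulerCoeff (γ / 2) ε * eulerCoeff (-(γ / 2)) ε' *
        ((2 ^ n : ℂ)⁻¹ * rotatedZs β S.1 x (x + δ) * (parity S.1 x : ℂ) ^ (ε : ℕ) *
      (parity S.1 (x + δ) : ℂ) ^ (ε' : ℕ) * (damping d γ : ℂ) ^ (supp δ).card) := by
    rw [exp_halfChange, exp_neg_nat_mul, Complex.ofReal_pow, Finset.sum_mul, Finset.mul_sum]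
    refine Finset.sum_congr rfl fun ε _ => ?_
    rw [Finset.sum_mul, Finset.mul_sum]
    refine Finset.sum_congr rfl fun ε' _ => ?_
    ring
  simp_rw [h]
  rw [limitWeight, Finset.mul_sum]
  simp_rw [Finset.sum_comm (s := (Finset.univ : Finset (Fin n → Fin 2)))
    (t := (Finset.univ : Finset (Fin 2)))]
  refine Finset.sum_congr rfl fun ε _ => ?_
  rw [Finset.mul_sum]
  refine Finset.sum_congr rfl fun ε' _ => ?_
  simp_rw [← Finset.mul_sum]
  rw [sum_sum_qubits]
  ring

/-! ### The multinomial form of the limit. -/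

lemma bitSign_add (a b : ZMod 2) : bitSign (a + b) = bitSign a * bitSign b := by
  revert a b
  have h0 : bitSign 0 = 1 := by simp [bitSign]
  have h1 : bitSign 1 = -1 := by simp [bitSign, ZMod.val_one]
  intro a b
  fin_cases a <;> fin_cases b
  · change bitSign (0 + 0) = bitSign 0 * bitSign 0; simp [h0]
  · change bitSign (0 + 1) = bitSign 0 * bitSign 1; simp [h0]
  · change bitSign (1 + 0) = bitSign 1 * bitSign 0; simp [h0]
  · change bitSign (1 + 1) = bitSign 1 * bitSign 1
    rw [show (1 + 1 : ZMod 2) = 0 from rfl, h0, h1]; norm_num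

lemma bitSign_eq_or (a : ZMod 2) : bitSign a = 1 ∨ bitSign a = -1 := neg_one_pow_eq_or ℂ a.val

/-- The sign is a character of XOR, and even powers of a sign are trivial. -/
lemma bitSign_xorPow (Ds : Bits → ℕ) (j : Fin 3) :
    bitSign (xorPow Ds j) = ∏ s : Bits, bitSign (s j) ^ Ds s := by
  have hsum (t : Finset Bits) : bitSign (∑ s ∈ t, s j) = ∏ s ∈ t, bitSign (s j) := by
    classical
    induction t using Finset.induction_on with
    | empty => simp [bitSign]
    | insert a t ha ih => rw [Finset.sum_insert ha, Finset.prod_insert ha, bitSign_add, ih]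
  rw [xorPow, Finset.sum_apply, hsum, Finset.prod_filter]
  refine Finset.prod_congr rfl fun s _ => ?_
  split_ifs with h
  · rcases bitSign_eq_or (s j) with h' | h' <;> simp [h', h.neg_one_pow]
  · rcases bitSign_eq_or (s j) with h' | h' <;> simp [h', (Nat.not_odd_iff_even.1 h).neg_one_pow]

lemma exp_phase (γ : ℝ) (s : Bits) :
    Complex.exp (Complex.I * phase γ s) = ∑ ε : Fin 2, ∑ ε' : Fin 2,
      eulerCoeff (γ / 2) ε * eulerCoeff (-(γ / 2)) ε' *
        (bitSign (s 2) ^ (ε : ℕ) * bitSign (s 0) ^ (ε' : ℕ)) := by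
  have h : Complex.I * phase γ s =
      Complex.I * (((γ / 2 : ℝ) : ℂ) * bitSign (s 2)) +
        Complex.I * (((-(γ / 2) : ℝ) : ℂ) * bitSign (s 0)) := by
    rw [phase]; push_cast; ring
  rw [h, Complex.exp_add, exp_I_mul_sign _ (bitSign_eq_or _), exp_I_mul_sign _ (bitSign_eq_or _),
    Finset.sum_mul_sum]
  refine Finset.sum_congr rfl fun ε _ => Finset.sum_congr rfl fun ε' _ => ?_
  ring

/-- A bitstring of length 3 is given by its three bits. -/
def bitsEquiv : ZMod 2 × ZMod 2 × ZMod 2 ≃ Bits where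
  toFun t := bits t.1 t.2.1 t.2.2
  invFun s := (s 2, s 1, s 0)
  left_inv _ := rfl
  right_inv s := by funext j; fin_cases j <;> rfl

lemma sum_bits (f : Bits → ℂ) :
    ∑ s, f s = f (bits 0 0 0) + f (bits 0 0 1) + f (bits 0 1 0) + f (bits 0 1 1) +
      f (bits 1 0 0) + f (bits 1 0 1) + f (bits 1 1 0) + f (bits 1 1 1) := by
  have h2 (g : ZMod 2 → ℂ) : ∑ a, g a = g 0 + g 1 := Fin.sum_univ_two g
  rw [← bitsEquiv.sum_comp]
  simp only [Fintype.sum_prod_type, h2]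
  change f (bits 0 0 0) + f (bits 0 0 1) + (f (bits 0 1 0) + f (bits 0 1 1)) +
    (f (bits 1 0 0) + f (bits 1 0 1) + (f (bits 1 1 0) + f (bits 1 1 1))) = _
  ring

/-- The contribution of one bitstring to the limit, with the signs of its outer bits. -/
def bitsWeight (d β γ : ℝ) (ε ε' : Fin 2) (s : Bits) : ℂ :=
  bitSign (s 2) ^ (ε : ℕ) * bitSign (s 0) ^ (ε' : ℕ) * (-1) ^ (s 1).val *
    (if s ∈ oddBits then -1 else 1) * (if s 2 ≠ s 0 then (damping d γ : ℂ) else 1) *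
    mixerWeight β s

/-- The sum over `s₁` expands the entry of `mixerGateᴴ * pauliZ * mixerGate` in row `s₂` and column
`s₀`. The sign on `oddBits` turns `i sin` into the `-i sin` of the unconjugated gate. -/
lemma sum_bitsWeight (d β γ : ℝ) (ε ε' : Fin 2) :
    ∑ s, bitsWeight d β γ ε ε' s = qubitWeight d β γ ε ε' := by
  have h0 : bitSign 0 = 1 := by simp [bitSign]
  have h1 : bitSign 1 = -1 := by simp [bitSign, ZMod.val_one]
  rw [sum_bits, qubitWeight]
  have hadd : (1 + 1 : Fin 2) = 0 := rfl
  simp only [bitsWeight, bits, oddBits, mixerWeight, Finset.mem_filter, Finset.mem_univ, true_and,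
    Fin.sum_univ_two, Matrix.cons_val_zero, Matrix.cons_val_one, Matrix.cons_val, h0, h1,
    zero_add, add_zero, hadd, rotatedZ, cos_eq_half β, sin_eq_half β]
  simp [-Complex.ofReal_div, -Complex.ofReal_cos, -Complex.ofReal_sin, ZMod.val_one]
  generalize (Real.cos (β / 2) : ℂ) = c
  generalize (Real.sin (β / 2) : ℂ) = s
  generalize (damping d γ : ℂ) = l
  linear_combination (s ^ 2 - s ^ 2 * (-1) ^ (ε' : ℕ) * (-1) ^ (ε : ℕ)) * Complex.I_sq

lemma prod_bitsWeight_pow (d β γ : ℝ) (ε ε' : Fin 2) (Ds : Bits → ℕ) :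
    ∏ s, bitsWeight d β γ ε ε' s ^ Ds s =
      (bitSign (xorPow Ds 2) ^ (ε : ℕ) * bitSign (xorPow Ds 0) ^ (ε' : ℕ)) *
        (-1) ^ (∑ s : Bits, Ds s * (s 1).val) * (-1) ^ (∑ s ∈ oddBits, Ds s) *
        ((Real.exp (-(((Ds (bits 0 0 1) + Ds (bits 0 1 1) + Ds (bits 1 0 0) +
          Ds (bits 1 1 0) : ℕ) : ℝ) * d * (1 - Real.cos γ))) : ℝ) : ℂ) *
        ∏ s, mixerWeight β s ^ Ds s := by
  simp only [bitsWeight, mul_pow, Finset.prod_mul_distrib]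
  congr 1
  congr 1
  · congr 1
    · congr 1
      · rw [bitSign_xorPow, bitSign_xorPow, ← Finset.prod_pow, ← Finset.prod_pow]
        simp only [← pow_mul, mul_comm]
      · rw [← Finset.prod_pow_eq_pow_sum]
        simp only [← pow_mul, mul_comm]
    · rw [← Finset.prod_pow_eq_pow_sum, ← Finset.prod_subset (Finset.subset_univ oddBits)]
      · exact Finset.prod_congr rfl fun s hs => by rw [if_pos hs]
      · intro s _ hs
        rw [if_neg hs, one_pow]
  · rw [exp_neg_nat_mul, Complex.ofReal_pow]
    -- The four listed strings are those whose outer bits differ, that is, the flipped qubits.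
    have hs : (∑ s : Bits, if s 2 ≠ s 0 then Ds s else 0) =
        Ds (bits 0 0 1) + Ds (bits 0 1 1) + Ds (bits 1 0 0) + Ds (bits 1 1 0) := by
      have := sum_bits fun s => ((if s 2 ≠ s 0 then Ds s else 0 : ℕ) : ℂ)
      rw [← Nat.cast_sum] at this
      have h' : ((∑ s : Bits, if s 2 ≠ s 0 then Ds s else 0 : ℕ) : ℂ) =
          ((Ds (bits 0 0 1) + Ds (bits 0 1 1) + Ds (bits 1 0 0) + Ds (bits 1 1 0) : ℕ) : ℂ) := by
        rw [this]
        simp [bits]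
      exact_mod_cast h'
    rw [← hs, ← Finset.prod_pow_eq_pow_sum]
    refine Finset.prod_congr rfl fun s _ => ?_
    split_ifs <;> simp

/-- The multinomial theorem is applied for each `ε`, `ε'`; summing over them then recombines the
Euler coefficients into the phase of the XOR (`exp_phase`). -/
lemma limitWeight_eq_sum_piAntidiag (D : ℕ) (d β γ : ℝ) :
    limitWeight D d β γ =
      ∑ Ds ∈ Finset.piAntidiag (Finset.univ : Finset Bits) D,
        (Nat.multinomial Finset.univ Ds : ℂ) * Complex.exp (Complex.I * phase γ (xorPow Ds)) *
          (-1) ^ (∑ s : Bits, Ds s * (s 1).val) * (-1) ^ (∑ s ∈ oddBits, Ds s) *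
          ((Real.exp (-(((Ds (bits 0 0 1) + Ds (bits 0 1 1) + Ds (bits 1 0 0) +
            Ds (bits 1 1 0) : ℕ) : ℝ) * d * (1 - Real.cos γ))) : ℝ) : ℂ) *
          ∏ s : Bits, mixerWeight β s ^ Ds s := by
  simp_rw [limitWeight, ← sum_bitsWeight, Finset.sum_pow_eq_sum_piAntidiag, prod_bitsWeight_pow,
    exp_phase, Finset.mul_sum, Finset.sum_mul]
  refine (Finset.sum_congr rfl fun ε _ => Finset.sum_comm).trans (Finset.sum_comm.trans ?_)
  refine Finset.sum_congr rfl fun Ds _ => Finset.sum_congr rfl fun ε _ =>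
    Finset.sum_congr rfl fun ε' _ => ?_
  ring

/-! ### Uniform error bounds and the limit. -/

/-- The indicator that `δ` vanishes off `S`. -/
def supportedOn {n : ℕ} (S : Finset (Fin n)) (δ : Fin n → Fin 2) : ℝ :=
  ∏ k, if k ∈ S then 1 else if δ k = 0 then 1 else 0

lemma supportedOn_nonneg {n : ℕ} (S : Finset (Fin n)) (δ : Fin n → Fin 2) :
    0 ≤ supportedOn S δ :=
  Finset.prod_nonneg fun k _ => by split_ifs <;> norm_num

lemma supp_subset_of_supportedOn_ne_zero {n : ℕ} {S : Finset (Fin n)} {δ : Fin n → Fin 2}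
    (h : supportedOn S δ ≠ 0) : supp δ ⊆ S := by
  intro k hk
  by_contra hkS
  refine h (Finset.prod_eq_zero (Finset.mem_univ k) ?_)
  rw [if_neg hkS, if_neg (Finset.mem_filter.1 hk).2]

lemma sum_supportedOn {n D : ℕ} (S : Hyperedge n D) : ∑ δ, supportedOn S.1 δ = 2 ^ D := by
  simp only [supportedOn]
  rw [← Fintype.prod_sum fun k (b : Fin 2) => if k ∈ S.1 then (1 : ℝ) else if b = 0 then 1 else 0]
  have hk (k : Fin n) : (∑ b : Fin 2, if k ∈ S.1 then (1 : ℝ) else if b = 0 then 1 else 0) =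
      if k ∈ S.1 then 2 else 1 := by
    split_ifs <;> norm_num
  simp_rw [hk]
  rw [Finset.prod_ite_mem, Finset.univ_inter, Finset.prod_const, S.2]

lemma norm_rotatedZ_le (β : ℝ) (a b : Fin 2) : ‖rotatedZ β a b‖ ≤ 1 := by
  have hc := Real.abs_cos_le_one β
  have hs := Real.abs_sin_le_one β
  fin_cases a <;> fin_cases b <;>
    simpa [-Complex.ofReal_cos, -Complex.ofReal_sin, rotatedZ]

lemma norm_rotatedZs_le {n : ℕ} (β : ℝ) (S : Finset (Fin n)) (x δ : Fin n → Fin 2) :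
    ‖rotatedZs β S x (x + δ)‖ ≤ supportedOn S δ := by
  rw [rotatedZs, tensorOp, norm_prod, supportedOn]
  refine Finset.prod_le_prod (fun _ _ => norm_nonneg _) fun k _ => ?_
  split_ifs with h1 h2
  · exact norm_rotatedZ_le β _ _
  · rw [Pi.add_apply, h2, add_zero, Matrix.one_apply_eq, norm_one]
  · rw [Pi.add_apply, Matrix.one_apply_ne fun h => h2 (by simpa using h), norm_zero]

/-- Only the `2 ^ D` flips supported on `S` contribute, and each has matrix entries of norm at most
`1`, so the bound does not depend on `S`. -/
lemma norm_edgeEnergy_sub_le {D n : ℕ} (hD : 2 ≤ D) (hn : D ≤ n) {d : ℝ} (hd : 0 ≤ d)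
    (hp : rawProb D n d ≤ 1 / 2) (β γ : ℝ) (S : Hyperedge n D) :
    ‖edgeEnergy D n (rawProb D n d) β γ S - (2 ^ D : ℂ)⁻¹ * limitWeight D d β γ‖ ≤
      2 ^ D * poissonError D n d := by
  rw [← sum_sum_damped S, edgeEnergy, ← Finset.sum_sub_distrib]
  simp_rw [← Finset.sum_sub_distrib, ← mul_sub]
  rw [Finset.sum_comm, ← sum_supportedOn S, Finset.sum_mul]
  refine (norm_sum_le _ _).trans (Finset.sum_le_sum fun δ _ => ?_)
  refine (norm_sum_le _ _).trans ?_
  by_cases h0 : supportedOn S.1 δ = 0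
  · have hz (x : Fin n → Fin 2) : rotatedZs β S.1 x (x + δ) = 0 :=
      norm_le_zero_iff.1 (h0 ▸ norm_rotatedZs_le β S.1 x δ)
    simp [hz, h0]
  have hδ : (supp δ).card ≤ D :=
    (Finset.card_le_card (supp_subset_of_supportedOn_ne_zero h0)).trans_eq S.2
  have hsum := sum_norm_prod_edgeFactor_sub_le hD hn hd hp γ S δ hδ
  calc _ ≤ ∑ x, (2 ^ n : ℝ)⁻¹ * supportedOn S.1 δ *
        ‖∏ T ∈ Finset.univ.erase S, edgeFactor (rawProb D n d) γ (halfChange T.1 x δ) -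
          ((Real.exp (-((supp δ).card * d * (1 - Real.cos γ))) : ℝ) : ℂ)‖ := by
        refine Finset.sum_le_sum fun x _ => ?_
        rw [norm_mul, norm_mul, norm_mul, norm_exp_I_mul_ofReal_eq_one, one_mul, norm_inv, norm_pow,
          Complex.norm_ofNat]
        gcongr
        exact norm_rotatedZs_le β S.1 x δ
    _ ≤ (2 ^ n : ℝ)⁻¹ * supportedOn S.1 δ * (2 ^ n * poissonError D n d) := by
        rw [← Finset.mul_sum]
        have := supportedOn_nonneg S.1 δ
        gcongr
    _ = _ := by field_simp

lemma edgeProb_eq_rawProb {D n : ℕ} {d : ℝ} (hd : 0 ≤ d) (hp : rawProb D n d ≤ 1) :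
    (edgeProb D n d : ℝ) = rawProb D n d := by
  rw [edgeProb, Set.coe_projIcc, ← rawProb, min_eq_right hp, max_eq_right (rawProb_nonneg hd)]

/-- The mean number of edges per vertex is exactly `d / D`, which multiplies both the limit and the
error per edge. -/
lemma norm_expectedEnergy_sub_le {D n : ℕ} (hD : 2 ≤ D) (hn : D ≤ n) {d : ℝ} (hd : 0 ≤ d)
    (hp : rawProb D n d ≤ 1 / 2) (β γ : ℝ) :
    ‖expectedEnergy D n d β γ - (d : ℂ) / (2 ^ D * (D : ℂ)) * limitWeight D d β γ‖ ≤
      d / D * (2 ^ D * poissonError D n d) := by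
  have hcard : ((Finset.univ : Finset (Hyperedge n D)).card : ℝ) = n.choose D := by
    simp
  have hn0 : (n : ℝ) ≠ 0 := by exact_mod_cast (by omega : n ≠ 0)
  have hmul : (n : ℝ)⁻¹ * (n.choose D * rawProb D n d) = d / D := by
    rw [mul_comm (n.choose D : ℝ), rawProb_mul_choose (by omega) hn, inv_mul_cancel_left₀ hn0]
  have hmul' : (n : ℂ)⁻¹ * (n.choose D * (rawProb D n d : ℂ)) = d / D := by
    simpa using congrArg (fun t : ℝ => (t : ℂ)) hmul
  have hL : (d : ℂ) / (2 ^ D * (D : ℂ)) * limitWeight D d β γ =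
      (n : ℂ)⁻¹ * ∑ _S : Hyperedge n D,
        (rawProb D n d : ℂ) * ((2 ^ D : ℂ)⁻¹ * limitWeight D d β γ) := by
    have hcard' : ((Finset.univ : Finset (Hyperedge n D)).card : ℂ) = n.choose D := by
      exact_mod_cast hcard
    rw [Finset.sum_const, nsmul_eq_mul, hcard', ← mul_assoc _ (rawProb D n d : ℂ), ← mul_assoc,
      hmul']
    field_simp
  rw [expectedEnergy_eq, edgeProb_eq_rawProb hd (by linarith), hL, ← mul_sub,
    ← Finset.sum_sub_distrib, norm_mul, norm_inv, Complex.norm_natCast]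
  calc _ ≤ (n : ℝ)⁻¹ * ∑ _S : Hyperedge n D,
        rawProb D n d * (2 ^ D * poissonError D n d) := by
        gcongr
        refine (norm_sum_le _ _).trans (Finset.sum_le_sum fun S _ => ?_)
        rw [← mul_sub, norm_mul, Complex.norm_real, Real.norm_of_nonneg (rawProb_nonneg hd)]
        exact mul_le_mul_of_nonneg_left (norm_edgeEnergy_sub_le hD hn hd hp β γ S)
          (rawProb_nonneg hd)
    _ = _ := by
        rw [Finset.sum_const, nsmul_eq_mul, hcard, ← hmul]; ring

lemma tendsto_const_div_pred (c : ℝ) :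
    Tendsto (fun n : ℕ => c / ((n - 1 : ℕ) : ℝ)) atTop (𝓝 0) :=
  (tendsto_const_div_atTop_nhds_zero_nat c).comp (tendsto_sub_atTop_nat 1)

lemma tendsto_rawProb {D : ℕ} (hD : 2 ≤ D) {d : ℝ} (hd : 0 ≤ d) :
    Tendsto (fun n => rawProb D n d) atTop (𝓝 0) := by
  refine squeeze_zero' (Eventually.of_forall fun n => rawProb_nonneg hd) ?_
    (tendsto_const_div_pred (d * (D - 1 : ℕ)))
  filter_upwards [eventually_ge_atTop D] with n hn
  rw [mul_div_assoc, ← rawProb_mul_choose_pred_pred hD hn d]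
  -- The probability is at most the mean codegree, because `C(n-2, D-2) ≥ 1`.
  refine le_mul_of_one_le_right (rawProb_nonneg hd) ?_
  exact_mod_cast Nat.choose_pos (by omega)

lemma tendsto_degreeError {D : ℕ} (hD : 2 ≤ D) {d : ℝ} (hd : 0 ≤ d) :
    Tendsto (fun n => degreeError D n d) atTop (𝓝 0) := by
  simpa [degreeError] using
    (((tendsto_const_div_pred ((D - 1 : ℕ) : ℝ)).const_mul d).const_mul ((D : ℝ) * D)).add
      (tendsto_rawProb hD hd)

lemma tendsto_poissonError {D : ℕ} (hD : 2 ≤ D) {d : ℝ} (hd : 0 ≤ d) :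
    Tendsto (fun n => poissonError D n d) atTop (𝓝 0) := by
  have hp := tendsto_rawProb hD hd
  have he := tendsto_degreeError hD hd
  have hs := he.const_add ((D : ℝ) * d)
  simpa [poissonError] using
    (((hp.const_mul 4).mul hs).add (hs.sqrt.mul hp.sqrt)).add (he.const_mul 2)

lemma tendsto_expectedEnergy {D : ℕ} (hD : 2 ≤ D) {d : ℝ} (hd : 0 ≤ d) (β γ : ℝ) :
    Tendsto (fun n => expectedEnergy D n d β γ) atTop
      (𝓝 ((d : ℂ) / (2 ^ D * (D : ℂ)) * limitWeight D d β γ)) := by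
  rw [tendsto_iff_norm_sub_tendsto_zero]
  have hlim : Tendsto (fun n => d / D * (2 ^ D * poissonError D n d)) atTop (𝓝 0) := by
    simpa using ((tendsto_poissonError hD hd).const_mul ((2 : ℝ) ^ D)).const_mul (d / D)
  refine squeeze_zero' (Eventually.of_forall fun n => norm_nonneg _) ?_ hlim
  -- For large `n` the probability is at most `1/2`: the clipping to `[0, 1]` is inactive and the
  -- Taylor bound applies.
  filter_upwards [eventually_ge_atTop D,
    (tendsto_rawProb hD hd).eventually (ge_mem_nhds (by norm_num : (0 : ℝ) < 1 / 2))] with n hn hp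
  exact norm_expectedEnergy_sub_le hD hn hd hp β γ

end DilutedSpin

end

theorem mainTheorem5 (D : ℕ) (hD : 3 ≤ D) (d : ℝ) (hd : 0 ≤ d) (β γ : ℝ) :
    Tendsto (fun n : ℕ => DilutedSpin.expectedEnergy D n d β γ) atTop
      (𝓝 (((d : ℂ) / (2 ^ D * (D : ℂ))) *
        ∑ Ds ∈ Finset.piAntidiag (Finset.univ : Finset DilutedSpin.Bits) D,
          (Nat.multinomial Finset.univ Ds : ℂ)
            * Complex.exp (Complex.I * DilutedSpin.phase γ (DilutedSpin.xorPow Ds))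
            * (-1) ^ (∑ s : DilutedSpin.Bits, Ds s * (s 1).val)
            * (-1) ^ (∑ s ∈ DilutedSpin.oddBits, Ds s)
            * ((Real.exp (-(((Ds (DilutedSpin.bits 0 0 1) + Ds (DilutedSpin.bits 0 1 1)
                + Ds (DilutedSpin.bits 1 0 0) + Ds (DilutedSpin.bits 1 1 0) : ℕ) : ℝ)
                * d * (1 - Real.cos γ))) : ℝ) : ℂ)
            * ∏ s : DilutedSpin.Bits, DilutedSpin.mixerWeight β s ^ Ds s)) := by
  rw [← DilutedSpin.limitWeight_eq_sum_piAntidiag]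
  exact DilutedSpin.tendsto_expectedEnergy (by omega) hd β γ
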